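/- Let $H$ be a finite (simple, undirected) pattern graph that contains a 4-clique. In $H$-detection the nodes of a network $G$ have to decide whether $G$ has a subgraph isomorphic to $H$, and in induced $H$-detection whether $G$ has an induced subgraph isomorphic to $H$. Consider the $\mathsf{CONGEST}$ model on connected $n$-node networks: the nodes have distinct identifiers $0,\dots,n-1$, each node initially knows $n$, its own identifier, the identifiers of its neighbours and its random coins (private or shared), local computation is free, and in each synchronous round every node may send a message of at most $B(n)=O(\log n)$ bits to each neighbour, with different messages to different neighbours allowed. A (randomized) algorithm solves a decision problem in $T$ rounds if on every connected $n$-node network, with probability at least $2/3$, after $T$ rounds at least one node outputs "yes" if the answer is yes, and no node outputs "yes" if the answer is no; deterministic algorithms are a special case. Then any $\mathsf{CONGEST}$ algorithm that solves either $H$-detection or induced $H$-detection needs $\Omega(n^{1/2}/\log n)$ rounds. That is, for every real $b$ there are $c>0$ and $n_0$, depending only on $H$ and $b$, such that for every $n\ge n_0$, every algorithm with messages of at most $B\le b\log n$ bits that solves $H$-detection or induced $H$-detection on connected $n$-node networks in $T$ rounds satisfies $T\ge c\,n^{1/2}/\log n$. -/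

import Mathlib

open MeasureTheory

namespace Congest

/-- A message of at most `B` bits (the empty message is allowed). -/
abbrev Message (B : ℕ) : Type := {l : List Bool // l.length ≤ B}

/-- A (randomized) algorithm in the `CONGEST` model with bandwidth `B` for networks on `n` nodes.

The nodes carry the distinct identifiers `0, …, n - 1`, and are named by them. All nodes run the
same code, know `n` and `B`, and have unbounded local computation. At the start a node knows its own
identifier, the identifiers of its neighbours and its random seed. In every round, a node sends to
each of its neighbours a message of at most `B` bits (possibly different ones to different
neighbours), and then updates its state from the messages that it has received.

`law` is the joint law of the seeds of all nodes. Private coins are the case of a product measure,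
shared coins the case of a law on the diagonal, and deterministic algorithms the case `Seed = Unit`. -/
structure Algorithm (n B : ℕ) where
  /-- The random seeds of a node. -/
  Seed : Type
  /-- The measurable space of seeds. -/
  seedSpace : MeasurableSpace Seed
  /-- The joint law of the seeds of all nodes. -/
  law : Measure (Fin n → Seed)
  /-- The joint law is a probability measure. -/
  law_prob : IsProbabilityMeasure law
  /-- The local states of a node. -/
  State : Type
  /-- The state before the first round, from the identifier of the node, the identifiers of its
  neighbours, and its seed. -/
  start : Fin n → Set (Fin n) → Seed → State
  /-- The message that a node in the given state sends to the neighbour with the given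
  identifier. -/
  send : State → Fin n → Message B
  /-- The new state, from the old one and the messages received in this round; the entry of `u` is
  `none` if `u` is not a neighbour. -/
  step : State → (Fin n → Option (Message B)) → State
  /-- The local output: `true` means that the node reports that the property holds. -/
  output : State → Bool

namespace Algorithm

variable {n B : ℕ}

open Classical in
/-- The state of every node after `t` rounds on the network `G`, for given seeds. -/
noncomputable def run (A : Algorithm n B) (G : SimpleGraph (Fin n)) (seed : Fin n → A.Seed) :
    ℕ → Fin n → A.State
  | 0 => fun v => A.start v (G.neighborSet v) (seed v)
  | t + 1 => fun v => A.step (A.run G seed t v)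
      (fun u => if G.Adj u v then some (A.send (A.run G seed t u) v) else none)

/-- After `T` rounds, at least one node outputs `true`. -/
def Accepts (A : Algorithm n B) (G : SimpleGraph (Fin n)) (T : ℕ) (seed : Fin n → A.Seed) : Prop :=
  ∃ v, A.output (A.run G seed T v) = true

/-- `A` decides the graph predicate `P` in `T` rounds: on each connected network `G` on `n` nodes,
with probability at least `2 / 3`, after `T` rounds some node outputs `true` if `G` satisfies `P`,
and no node does if `G` does not satisfy `P`. -/
def DecidesIn (A : Algorithm n B) (P : SimpleGraph (Fin n) → Prop) (T : ℕ) : Prop :=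
  ∀ G : SimpleGraph (Fin n), G.Connected →
    letI := A.seedSpace
    MeasurableSet {seed | A.Accepts G T seed ↔ P G} ∧
      2 / 3 ≤ A.law.real {seed | A.Accepts G T seed ↔ P G}

/-- `A` solves `H`-detection in `T` rounds: does the network have a subgraph isomorphic to `H`? -/
def SolvesDetection (A : Algorithm n B) {W : Type*} (H : SimpleGraph W) (T : ℕ) : Prop :=
  A.DecidesIn (fun G => H.IsContained G) T

/-- `A` solves induced `H`-detection in `T` rounds: does the network have an induced subgraph
isomorphic to `H`? -/
def SolvesInducedDetection (A : Algorithm n B) {W : Type*} (H : SimpleGraph W) (T : ℕ) : Prop :=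
  A.DecidesIn (fun G => H.IsIndContained G) T

end Algorithm

end Congest

/-!
Two players who hold sets of elements of a ground set of size `q ^ 4`, with `q` of order `√n`, can
decide whether their sets meet by simulating a detection algorithm on a network built from their
inputs. Every vertex `w` of `H` is blown up to `q ^ 2` copies, and an element of the ground set
selects one copy of each vertex, so that a common element yields an induced copy of `H`.

For the converse, take a family, of minimum size, of 4-colourable vertex sets that contains every
4-clique of `H` in one of its members, and colour one member `C` with four colours, the colours
`0`, `1` going to the first player and `2`, `3` to the second. By minimality, a copy of `H` in the
network must contain a 4-clique that projects into `C`, and the coordinates of its four nodes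
determine a common element of the two sets.

A node of the first player and a node of the second share a coordinate, hence only `O(q ^ 3)` edges
join the two sides, and `T` rounds cost `O(q ^ 3 B T)` bits. Deciding disjointness costs `Ω(q ^ 4)`
bits even with randomness (Kalyanasundaram–Schnitger, Razborov): a rectangle that contains many
disjoint pairs must contain many intersecting ones. Hence `B T = Ω(q)`.
-/

namespace Congest

section Disjointness

open Finset Real

theorem card_mul_exp_le_sum_exp {ι : Type*} (s : Finset ι) (f : ι → ℝ) (w : ℝ)
    (hw : #s * w ≤ ∑ i ∈ s, f i) : #s * exp w ≤ ∑ i ∈ s, exp (f i) := by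
  have tangent (i : ι) : exp w * (f i - w + 1) ≤ exp (f i) := calc
    exp w * (f i - w + 1) ≤ exp w * exp (f i - w) := by gcongr; exact add_one_le_exp _
    _ = exp (f i) := by rw [← exp_add, add_sub_cancel]
  calc #s * exp w ≤ exp w * (∑ i ∈ s, f i - #s * w + #s) := by
        rw [mul_comm]
        gcongr
        linarith
    _ = ∑ i ∈ s, exp w * (f i - w + 1) := by
        rw [← mul_sum, sum_add_distrib, sum_sub_distrib]
        simp only [sum_const, nsmul_eq_mul, mul_one]
    _ ≤ ∑ i ∈ s, exp (f i) := sum_le_sum fun i _ => tangent i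

variable {U : Type*} [DecidableEq U]

theorem sum_powerset_exp_signed_sum {S J : Finset U} (hJ : J ⊆ S) (s : ℝ) :
    ∑ x ∈ S.powerset, exp (∑ i ∈ J, if i ∈ x then s else -s) = 2 ^ #S * cosh s ^ #J := by
  have term (x : Finset U) (hx : x ∈ S.powerset) :
      exp (∑ i ∈ J, if i ∈ x then s else -s) =
        (∏ i ∈ x, if i ∈ J then exp s else 1) * ∏ i ∈ S \ x, if i ∈ J then exp (-s) else 1 := by
    rw [mem_powerset] at hx
    have extend : ∑ i ∈ J, (if i ∈ x then s else -s) =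
        ∑ i ∈ S, if i ∈ J then (if i ∈ x then s else -s) else 0 := by
      rw [sum_ite_mem, inter_eq_right.2 hJ]
    rw [extend, exp_sum, ← prod_sdiff hx, mul_comm]
    congr 1 <;> refine prod_congr rfl fun i hi => ?_
    · simp only [hi, if_true, apply_ite exp, exp_zero]
    · simp only [(mem_sdiff.1 hi).2, if_false, apply_ite exp, exp_zero]
  calc ∑ x ∈ S.powerset, exp (∑ i ∈ J, if i ∈ x then s else -s)
      = ∏ i ∈ S, ((if i ∈ J then exp s else 1) + if i ∈ J then exp (-s) else 1) := by
        rw [prod_add, sum_congr rfl term]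
    _ = ∏ i ∈ S, 2 * if i ∈ J then cosh s else 1 := by
        refine prod_congr rfl fun i _ => ?_
        split_ifs
        · rw [cosh_eq]; ring
        · norm_num
    _ = 2 ^ #S * cosh s ^ #J := by
        rw [prod_mul_distrib, prod_const, prod_ite_mem, inter_eq_right.2 hJ, prod_const]

theorem sum_signed_eq (𝒜 : Finset (Finset U)) (i : U) (s : ℝ) :
    ∑ x ∈ 𝒜, (if i ∈ x then s else -s) =
      s * (#(𝒜.memberSubfamily i) - #(𝒜.nonMemberSubfamily i)) := by
  rw [sum_ite, sum_const, sum_const, ← image_insert_memberSubfamily, nonMemberSubfamily,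
    card_image_of_injOn (insert_erase_invOn.2.injOn.mono ?_)]
  · simp only [nsmul_eq_mul]
    ring
  · intro x hx
    exact (mem_memberSubfamily.1 hx).2

theorem card_le_of_biased {S J : Finset U} (hJ : J ⊆ S) {𝒜 : Finset (Finset U)}
    (h𝒜 : 𝒜 ⊆ S.powerset) (s : ℝ)
    (h : ∀ i ∈ J, s ^ 2 * #𝒜 ≤ s * (#(𝒜.memberSubfamily i) - #(𝒜.nonMemberSubfamily i))) :
    #𝒜 ≤ 2 ^ #S * exp (-(s ^ 2 / 2 * #J)) := by
  have mean : #𝒜 * (s ^ 2 * #J) ≤ ∑ x ∈ 𝒜, ∑ i ∈ J, if i ∈ x then s else -s := by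
    rw [sum_comm, mul_comm, mul_right_comm, mul_comm, ← nsmul_eq_mul]
    exact card_nsmul_le_sum _ _ _ fun i hi => (h i hi).trans_eq (sum_signed_eq 𝒜 i s).symm
  have moment : #𝒜 * exp (s ^ 2 * #J) ≤ 2 ^ #S * exp (s ^ 2 / 2 * #J) := calc
    #𝒜 * exp (s ^ 2 * #J) ≤ ∑ x ∈ 𝒜, exp (∑ i ∈ J, if i ∈ x then s else -s) :=
      card_mul_exp_le_sum_exp _ _ _ mean
    _ ≤ ∑ x ∈ S.powerset, exp (∑ i ∈ J, if i ∈ x then s else -s) :=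
      sum_le_sum_of_subset_of_nonneg h𝒜 fun _ _ _ => (exp_pos _).le
    _ = 2 ^ #S * cosh s ^ #J := sum_powerset_exp_signed_sum hJ s
    _ ≤ 2 ^ #S * exp (s ^ 2 / 2) ^ #J := by
      gcongr
      exact cosh_le_exp_half_sq s
    _ = 2 ^ #S * exp (s ^ 2 / 2 * #J) := by rw [← exp_nat_mul, mul_comm (#J : ℝ)]
  rw [← mul_le_mul_iff_left₀ (exp_pos (s ^ 2 * #J))]
  calc #𝒜 * exp (s ^ 2 * #J) ≤ 2 ^ #S * exp (s ^ 2 / 2 * #J) := moment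
    _ = 2 ^ #S * exp (-(s ^ 2 / 2 * #J)) * exp (s ^ 2 * #J) := by
      rw [mul_assoc, ← exp_add]
      ring_nf

/-- Fewer than `9 / 20` of the members of `𝒜` contain `i`. A large family has few rare elements; for
the others, the members with and without `i` are comparable in number. -/
def IsRare (𝒜 : Finset (Finset U)) (i : U) : Prop :=
  11 * #(𝒜.memberSubfamily i) < 9 * #(𝒜.nonMemberSubfamily i)

instance (𝒜 : Finset (Finset U)) : DecidablePred (IsRare 𝒜) :=
  fun _ => inferInstanceAs (Decidable (_ < _))

/-- The rate `1 / 10000` is `s ^ 2 / 2 * (1 / 50)`. -/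
theorem card_biased_le {S J : Finset U} (hJ : J ⊆ S) {𝒜 : Finset (Finset U)}
    (h𝒜 : 𝒜 ⊆ S.powerset) (hlarge : 2 ^ #S * exp (-(#S / 10000 : ℝ)) < #𝒜) {s : ℝ}
    (hs : s ^ 2 = 1 / 100)
    (h : ∀ i ∈ J, s ^ 2 * #𝒜 ≤ s * (#(𝒜.memberSubfamily i) - #(𝒜.nonMemberSubfamily i))) :
    (#J : ℝ) ≤ #S / 50 := by
  have hlt := hlarge.trans_le (card_le_of_biased hJ h𝒜 s h)
  rw [mul_lt_mul_iff_right₀ (by positivity), exp_lt_exp, hs] at hlt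
  linarith

theorem cast_card_member_add_nonMember (𝒜 : Finset (Finset U)) (i : U) :
    (#(𝒜.memberSubfamily i) + #(𝒜.nonMemberSubfamily i) : ℝ) = #𝒜 := by
  exact_mod_cast card_memberSubfamily_add_card_nonMemberSubfamily i 𝒜

theorem card_filter_isRare_le {S : Finset U} {𝒜 : Finset (Finset U)} (h𝒜 : 𝒜 ⊆ S.powerset)
    (hlarge : 2 ^ #S * exp (-(#S / 10000 : ℝ)) < #𝒜) :
    (#{i ∈ S | IsRare 𝒜 i} : ℝ) ≤ #S / 50 := by
  refine card_biased_le (filter_subset _ _) h𝒜 hlarge (s := -(1 / 10)) (by norm_num)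
    fun i hi => ?_
  have hrare : (11 * #(𝒜.memberSubfamily i) : ℝ) < 9 * #(𝒜.nonMemberSubfamily i) := by
    exact_mod_cast (mem_filter.1 hi).2
  linarith [cast_card_member_add_nonMember 𝒜 i]

theorem le_sum_card_nonMemberSubfamily {S : Finset U} {𝒜 : Finset (Finset U)}
    (h𝒜 : 𝒜 ⊆ S.powerset) (hlarge : 2 ^ #S * exp (-(#S / 10000 : ℝ)) < #𝒜) :
    2 / 5 * (#S * #𝒜 : ℝ) ≤ ∑ i ∈ S, (#(𝒜.nonMemberSubfamily i) : ℝ) := by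
  let F := {i ∈ S | (#(𝒜.nonMemberSubfamily i) : ℝ) ≤ 9 / 20 * #𝒜}
  have hF : (#F : ℝ) ≤ #S / 50 := by
    refine card_biased_le (filter_subset _ _) h𝒜 hlarge (s := 1 / 10) (by norm_num)
      fun i hi => ?_
    linarith [cast_card_member_add_nonMember 𝒜 i, (mem_filter.1 hi).2]
  calc 2 / 5 * (#S * #𝒜 : ℝ) ≤ (#S - #F) * (9 / 20 * #𝒜) := by
        nlinarith [mul_le_mul_of_nonneg_right hF (Nat.cast_nonneg (α := ℝ) #𝒜),
          mul_nonneg (Nat.cast_nonneg (α := ℝ) #S) (Nat.cast_nonneg (α := ℝ) #𝒜)]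
    _ = #(S \ F) • (9 / 20 * #𝒜 : ℝ) := by
        rw [nsmul_eq_mul, cast_card_sdiff (filter_subset _ _)]
    _ ≤ ∑ i ∈ S \ F, (#(𝒜.nonMemberSubfamily i) : ℝ) :=
        card_nsmul_le_sum _ _ _ fun i hi => by
          simp only [F, mem_sdiff, mem_filter, not_and, not_le] at hi
          exact (hi.2 hi.1).le
    _ ≤ ∑ i ∈ S, (#(𝒜.nonMemberSubfamily i) : ℝ) :=
        sum_le_sum_of_subset_of_nonneg sdiff_subset fun _ _ _ => Nat.cast_nonneg _

theorem sum_isRare_le {S : Finset U} {𝒜 : Finset (Finset U)} (h𝒜 : 𝒜 ⊆ S.powerset) :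
    ∑ i ∈ S with IsRare 𝒜 i, (#(𝒜.nonMemberSubfamily i) : ℝ) ≤
      1 / 20 * ∑ i ∈ S, (#(𝒜.nonMemberSubfamily i) : ℝ) +
        #S * (2 ^ #S * exp (-(#S / 10000 : ℝ))) := by
  have hle : ∑ i ∈ S with IsRare 𝒜 i, (#(𝒜.nonMemberSubfamily i) : ℝ) ≤
      #{i ∈ S | IsRare 𝒜 i} * #𝒜 := by
    rw [← nsmul_eq_mul]
    exact sum_le_card_nsmul _ _ _ fun i _ => Nat.cast_le.2 (card_filter_le _ _)
  rcases lt_or_ge (2 ^ #S * exp (-(#S / 10000 : ℝ))) (#𝒜 : ℝ) with hlarge | hsmall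
  · have hrare := mul_le_mul_of_nonneg_right (card_filter_isRare_le h𝒜 hlarge)
      (Nat.cast_nonneg (α := ℝ) #𝒜)
    have hsum := le_sum_card_nonMemberSubfamily h𝒜 hlarge
    have herr : 0 ≤ #S * (2 ^ #S * exp (-(#S / 10000 : ℝ))) := by positivity
    linarith
  · calc _ ≤ (#{i ∈ S | IsRare 𝒜 i} * #𝒜 : ℝ) := hle
      _ ≤ #S * (2 ^ #S * exp (-(#S / 10000 : ℝ))) := by
        gcongr
        exact filter_subset _ _
      _ ≤ _ := le_add_of_nonneg_left (by positivity)

/-- The number of members of `𝒜` inside the set of `p = (S, i)` which do not contain `i`. -/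
def avoiding (𝒜 : Finset (Finset U)) (p : Finset U × U) : ℕ :=
  #((𝒜 ∩ p.1.powerset).nonMemberSubfamily p.2)

/-- The number of members of `𝒜` inside the set of `p = (S, i)` which contain `i`. -/
def hitting (𝒜 : Finset (Finset U)) (p : Finset U × U) : ℕ :=
  #((𝒜 ∩ p.1.powerset).memberSubfamily p.2)

theorem avoiding_eq_card_filter (𝒜 : Finset (Finset U)) (p : Finset U × U) :
    avoiding 𝒜 p = #{x ∈ (p.1.erase p.2).powerset | x ∈ 𝒜} := by
  refine congrArg card (ext fun x => ?_)
  simp only [mem_nonMemberSubfamily, mem_inter, mem_powerset, mem_filter, subset_erase]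
  tauto

theorem hitting_eq_card_filter (𝒜 : Finset (Finset U)) {p : Finset U × U} (hp : p.2 ∈ p.1) :
    hitting 𝒜 p = #{x ∈ (p.1.erase p.2).powerset | insert p.2 x ∈ 𝒜} := by
  refine congrArg card (ext fun x => ?_)
  simp only [mem_memberSubfamily, mem_inter, mem_powerset, mem_filter, subset_erase,
    insert_subset_iff]
  tauto

variable [Fintype U] {m : ℕ}

variable (U m) in
/-- The pairs of a set of size `m + 1` and one of its elements. -/
def pointedSets : Finset (Finset U × U) := {p | #p.1 = m + 1 ∧ p.2 ∈ p.1}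

/-- The other pointed set with the same point, whose sets meet in the point only and cover
everything. -/
def opposite (p : Finset U × U) : Finset U × U := (insert p.2 p.1ᶜ, p.2)

theorem mem_pointedSets {p : Finset U × U} :
    p ∈ pointedSets U m ↔ #p.1 = m + 1 ∧ p.2 ∈ p.1 := by
  simp only [pointedSets, mem_filter_univ]

theorem opposite_opposite {p : Finset U × U} (hp : p.2 ∈ p.1) : opposite (opposite p) = p := by
  refine Prod.ext ?_ rfl
  simp only [opposite, compl_insert, compl_compl]
  exact insert_erase hp

theorem opposite_mem_pointedSets (hU : Fintype.card U = 2 * m + 1) {p : Finset U × U}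
    (hp : p ∈ pointedSets U m) : opposite p ∈ pointedSets U m := by
  rw [mem_pointedSets] at hp ⊢
  refine ⟨?_, mem_insert_self _ _⟩
  rw [opposite, card_insert_of_notMem (by simpa using hp.2), card_compl]
  omega

theorem sum_pointedSets_opposite (hU : Fintype.card U = 2 * m + 1) (f : Finset U × U → ℝ) :
    ∑ p ∈ pointedSets U m, f (opposite p) = ∑ p ∈ pointedSets U m, f p :=
  sum_nbij' opposite opposite (fun _ => opposite_mem_pointedSets hU)
    (fun _ => opposite_mem_pointedSets hU)
    (fun _ hp => opposite_opposite (mem_pointedSets.1 hp).2)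
    (fun _ hp => opposite_opposite (mem_pointedSets.1 hp).2) fun _ _ => rfl

theorem sum_pointedSets (f : Finset U × U → ℝ) :
    ∑ p ∈ pointedSets U m, f p = ∑ S ∈ powersetCard (m + 1) univ, ∑ i ∈ S, f (S, i) :=
  sum_finset_product _ _ id fun p => by
    simp only [mem_pointedSets, mem_powersetCard_univ, id]

theorem avoiding_opposite (ℬ : Finset (Finset U)) {p : Finset U × U} (hp : p.2 ∈ p.1) :
    avoiding ℬ (opposite p) = #(ℬ ∩ p.1ᶜ.powerset) := by
  refine congrArg card (ext fun y => ?_)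
  simp only [opposite, mem_nonMemberSubfamily, mem_inter, mem_powerset, and_assoc]
  refine and_congr_right fun _ => ⟨fun ⟨hy, hpy⟩ => (subset_insert_iff_of_notMem hpy).1 hy,
    fun hy => ⟨hy.trans (subset_insert _ _), fun hpy => mem_compl.1 (hy hpy) hp⟩⟩

theorem card_inter_powerset_compl_le (hU : Fintype.card U = 2 * m + 1) (ℬ : Finset (Finset U))
    {S : Finset U} (hS : #S = m + 1) : (#(ℬ ∩ Sᶜ.powerset) : ℝ) ≤ 2 ^ m := by
  have hcompl : #Sᶜ = m := by rw [card_compl]; omega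
  exact_mod_cast (card_le_card inter_subset_right).trans_eq (by rw [card_powerset, hcompl])

theorem sum_isRare_mul_avoiding_le_of_card_eq (hU : Fintype.card U = 2 * m + 1)
    (𝒜 ℬ : Finset (Finset U)) {S : Finset U} (hS : #S = m + 1) :
    ∑ i ∈ S with IsRare (𝒜 ∩ S.powerset) i,
        (avoiding 𝒜 (S, i) * avoiding ℬ (opposite (S, i)) : ℝ) ≤
      1 / 20 * ∑ i ∈ S, (avoiding 𝒜 (S, i) * avoiding ℬ (opposite (S, i)) : ℝ) +
        #S * (2 * exp (-((m + 1) / 10000)) * 4 ^ m) := by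
  have hfactor (i : U) (hi : i ∈ S) : avoiding ℬ (opposite (S, i)) = #(ℬ ∩ Sᶜ.powerset) :=
    avoiding_opposite ℬ hi
  calc ∑ i ∈ S with IsRare (𝒜 ∩ S.powerset) i,
        (avoiding 𝒜 (S, i) * avoiding ℬ (opposite (S, i)) : ℝ)
      = (∑ i ∈ S with IsRare (𝒜 ∩ S.powerset) i, (avoiding 𝒜 (S, i) : ℝ)) *
          #(ℬ ∩ Sᶜ.powerset) := by
        rw [sum_mul]
        exact sum_congr rfl fun i hi => by rw [hfactor i (mem_filter.1 hi).1]
    _ ≤ (1 / 20 * ∑ i ∈ S, (avoiding 𝒜 (S, i) : ℝ) +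
          #S * (2 ^ #S * exp (-(#S / 10000 : ℝ)))) * #(ℬ ∩ Sᶜ.powerset) := by
        gcongr
        exact sum_isRare_le (inter_subset_right : 𝒜 ∩ S.powerset ⊆ S.powerset)
    _ ≤ 1 / 20 * (∑ i ∈ S, (avoiding 𝒜 (S, i) : ℝ)) * #(ℬ ∩ Sᶜ.powerset) +
          #S * (2 ^ #S * exp (-(#S / 10000 : ℝ))) * 2 ^ m := by
        rw [add_mul]
        gcongr
        exact card_inter_powerset_compl_le hU ℬ hS
    _ = 1 / 20 * ∑ i ∈ S, (avoiding 𝒜 (S, i) * avoiding ℬ (opposite (S, i)) : ℝ) +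
          #S * (2 * exp (-((m + 1) / 10000)) * 4 ^ m) := by
        rw [hS, Nat.cast_add_one, mul_assoc (1 / 20), sum_mul,
          show (4 : ℝ) ^ m = 2 ^ m * 2 ^ m by rw [← mul_pow]; norm_num,
          sum_congr rfl fun i hi => congrArg _ (congrArg _ (hfactor i hi)), ← sum_mul]
        ring

theorem sum_isRare_mul_avoiding_le (hU : Fintype.card U = 2 * m + 1) (𝒜 ℬ : Finset (Finset U)) :
    ∑ p ∈ pointedSets U m with IsRare (𝒜 ∩ p.1.powerset) p.2,
        (avoiding 𝒜 p * avoiding ℬ (opposite p) : ℝ) ≤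
      1 / 20 * ∑ p ∈ pointedSets U m, (avoiding 𝒜 p * avoiding ℬ (opposite p) : ℝ) +
        2 * exp (-((m + 1) / 10000)) * (#(pointedSets U m) * 4 ^ m) := by
  have herr : 2 * exp (-((m + 1) / 10000)) * (#(pointedSets U m) * 4 ^ m) =
      ∑ S ∈ powersetCard (m + 1) (univ : Finset U),
        #S * (2 * exp (-((m + 1) / 10000)) * 4 ^ m) := by
    rw [mul_left_comm, card_eq_sum_ones, Nat.cast_sum, sum_pointedSets, sum_mul]
    simp only [Nat.cast_one, sum_const, nsmul_eq_mul, mul_one]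
  rw [sum_filter, sum_pointedSets, sum_pointedSets, herr, mul_sum, ← sum_add_distrib]
  refine sum_le_sum fun S hS => ?_
  rw [← sum_filter]
  exact sum_isRare_mul_avoiding_le_of_card_eq hU 𝒜 ℬ (mem_powersetCard_univ.1 hS)

theorem sum_avoiding_le_sum_hitting (hU : Fintype.card U = 2 * m + 1)
    (𝒜 ℬ : Finset (Finset U)) :
    3 / 5 * ∑ p ∈ pointedSets U m, (avoiding 𝒜 p * avoiding ℬ (opposite p) : ℝ) ≤
      ∑ p ∈ pointedSets U m, (hitting 𝒜 p * hitting ℬ (opposite p) : ℝ) +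
        4 * exp (-((m + 1) / 10000)) * (#(pointedSets U m) * 4 ^ m) := by
  let rareSum (𝒞 𝒟 : Finset (Finset U)) : ℝ := ∑ p ∈ pointedSets U m,
    if IsRare (𝒞 ∩ p.1.powerset) p.2 then (avoiding 𝒞 p * avoiding 𝒟 (opposite p) : ℝ) else 0
  have hrare (𝒞 𝒟 : Finset (Finset U)) : rareSum 𝒞 𝒟 ≤ _ :=
    (sum_filter _ _).symm.trans_le (sum_isRare_mul_avoiding_le hU 𝒞 𝒟)
  have hswap : ∑ p ∈ pointedSets U m, (avoiding ℬ p * avoiding 𝒜 (opposite p) : ℝ) =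
      ∑ p ∈ pointedSets U m, (avoiding 𝒜 p * avoiding ℬ (opposite p) : ℝ) := by
    rw [← sum_pointedSets_opposite hU]
    exact sum_congr rfl fun p hp => by rw [opposite_opposite (mem_pointedSets.1 hp).2, mul_comm]
  have hcases : ∑ p ∈ pointedSets U m, (avoiding 𝒜 p * avoiding ℬ (opposite p) : ℝ) ≤
      rareSum 𝒜 ℬ + rareSum ℬ 𝒜 +
        121 / 81 * ∑ p ∈ pointedSets U m, (hitting 𝒜 p * hitting ℬ (opposite p) : ℝ) := by
    simp only [rareSum]
    rw [← sum_pointedSets_opposite hU fun p => if IsRare (ℬ ∩ p.1.powerset) p.2 then _ else _,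
      mul_sum, ← sum_add_distrib, ← sum_add_distrib]
    refine sum_le_sum fun p hp => ?_
    rw [opposite_opposite (mem_pointedSets.1 hp).2]
    have hnn : (0 : ℝ) ≤ avoiding 𝒜 p * avoiding ℬ (opposite p) := by positivity
    have hnn' : (0 : ℝ) ≤ hitting 𝒜 p * hitting ℬ (opposite p) := by positivity
    split_ifs with h𝒜 hℬ hℬ <;> try linarith
    have h𝒜 : (9 * avoiding 𝒜 p : ℝ) ≤ 11 * hitting 𝒜 p := mod_cast not_lt.1 h𝒜
    have hℬ : (9 * avoiding ℬ (opposite p) : ℝ) ≤ 11 * hitting ℬ (opposite p) :=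
      mod_cast not_lt.1 hℬ
    linarith [mul_le_mul h𝒜 hℬ (by positivity) (by positivity)]
  have herr : 0 ≤ exp (-((m + 1) / 10000)) * (#(pointedSets U m) * 4 ^ m : ℝ) := by positivity
  have hhit : (0 : ℝ) ≤ ∑ p ∈ pointedSets U m, (hitting 𝒜 p * hitting ℬ (opposite p) : ℝ) := by
    positivity
  linarith [hrare 𝒜 ℬ, hrare ℬ 𝒜]

variable (U m) in
/-- Disjoint inputs `x`, `y` of the two players, each presented together with a pointed set `p`
which contains `x`, and whose complement contains `y`; the point lies outside both inputs.
Uniformly distributed, these form the hard distribution of Razborov: adding the point to both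
inputs makes them intersect, while either player hardly sees the difference. -/
def disjointInputs : Finset ((Finset U × U) × Finset U × Finset U) :=
  {q | q.1 ∈ pointedSets U m ∧ q.2.1 ⊆ q.1.1.erase q.1.2 ∧ q.2.2 ⊆ q.1.1ᶜ}

theorem mem_disjointInputs {q : (Finset U × U) × Finset U × Finset U} :
    q ∈ disjointInputs U m ↔
      q.1 ∈ pointedSets U m ∧ q.2.1 ⊆ q.1.1.erase q.1.2 ∧ q.2.2 ⊆ q.1.1ᶜ := by
  simp only [disjointInputs, mem_filter_univ]

theorem disjoint_of_mem_disjointInputs {q : (Finset U × U) × Finset U × Finset U}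
    (hq : q ∈ disjointInputs U m) : Disjoint q.2.1 q.2.2 :=
  have ⟨_, hx, hy⟩ := mem_disjointInputs.1 hq
  disjoint_compl_right.mono (hx.trans (erase_subset _ _)) hy

theorem card_filter_disjointInputs (P : Finset U × U → Finset U → Prop)
    (Q : Finset U × U → Finset U → Prop) [∀ p, DecidablePred (P p)] [∀ p, DecidablePred (Q p)] :
    #{q ∈ disjointInputs U m | P q.1 q.2.1 ∧ Q q.1 q.2.2} =
      ∑ p ∈ pointedSets U m,
        #{x ∈ (p.1.erase p.2).powerset | P p x} * #{y ∈ p.1ᶜ.powerset | Q p y} := by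
  simp only [← card_product]
  rw [← card_sigma]
  refine card_nbij' (fun q => ⟨q.1, q.2⟩) (fun q => (q.1, q.2)) ?_ ?_ (fun _ _ => rfl)
    (fun _ _ => rfl) <;> intro q hq <;>
    simp only [coe_filter, mem_disjointInputs, Set.mem_ofPred_eq, coe_sigma, Set.mem_sigma_iff,
      mem_coe, mem_product, mem_filter, mem_powerset] at hq ⊢ <;> tauto

theorem card_disjointInputs (hU : Fintype.card U = 2 * m + 1) :
    #(disjointInputs U m) = #(pointedSets U m) * 4 ^ m := by
  have h := card_filter_disjointInputs (U := U) (m := m) (fun _ _ => True) (fun _ _ => True)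
  simp only [and_self, filter_true, card_powerset] at h
  rw [h, ← smul_eq_mul, ← sum_const]
  refine sum_congr rfl fun p hp => ?_
  obtain ⟨hcard, hmem⟩ := mem_pointedSets.1 hp
  rw [card_erase_of_mem hmem, card_compl, hcard, hU, ← pow_add,
    show m + 1 - 1 + (2 * m + 1 - (m + 1)) = 2 * m by omega, pow_mul]
  norm_num

theorem disjointInputs_nonempty (hU : Fintype.card U = 2 * m + 1) :
    (disjointInputs U m).Nonempty := by
  obtain ⟨S, hS⟩ : (powersetCard (m + 1) (univ : Finset U)).Nonempty :=
    powersetCard_nonempty.2 (by rw [card_univ]; omega)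
  have hS : #S = m + 1 := mem_powersetCard_univ.1 hS
  obtain ⟨i, hi⟩ : S.Nonempty := card_pos.1 (by omega)
  exact ⟨((S, i), ∅, ∅), mem_disjointInputs.2
    ⟨mem_pointedSets.2 ⟨hS, hi⟩, empty_subset _, empty_subset _⟩⟩

theorem erase_opposite {p : Finset U × U} (hp : p.2 ∈ p.1) :
    (opposite p).1.erase (opposite p).2 = p.1ᶜ :=
  erase_insert (by simpa using hp)

theorem card_disjointInputs_rectangle (𝒜 ℬ : Finset (Finset U)) :
    #{q ∈ disjointInputs U m | q.2.1 ∈ 𝒜 ∧ q.2.2 ∈ ℬ} =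
      ∑ p ∈ pointedSets U m, avoiding 𝒜 p * avoiding ℬ (opposite p) := by
  rw [card_filter_disjointInputs (fun _ x => x ∈ 𝒜) (fun _ y => y ∈ ℬ)]
  refine sum_congr rfl fun p hp => ?_
  rw [avoiding_eq_card_filter, avoiding_eq_card_filter, erase_opposite (mem_pointedSets.1 hp).2]

theorem card_disjointInputs_insert_rectangle (𝒜 ℬ : Finset (Finset U)) :
    #{q ∈ disjointInputs U m | insert q.1.2 q.2.1 ∈ 𝒜 ∧ insert q.1.2 q.2.2 ∈ ℬ} =
      ∑ p ∈ pointedSets U m, hitting 𝒜 p * hitting ℬ (opposite p) := by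
  rw [card_filter_disjointInputs (fun p x => insert p.2 x ∈ 𝒜) (fun p y => insert p.2 y ∈ ℬ)]
  refine sum_congr rfl fun p hp => ?_
  have hp := (mem_pointedSets.1 hp).2
  rw [hitting_eq_card_filter 𝒜 hp, hitting_eq_card_filter ℬ (mem_insert_self _ _),
    erase_opposite hp]
  rfl

theorem corruption_bound (hU : Fintype.card U = 2 * m + 1) (𝒜 ℬ : Finset (Finset U)) :
    3 / 5 * (#{q ∈ disjointInputs U m | q.2.1 ∈ 𝒜 ∧ q.2.2 ∈ ℬ} : ℝ) ≤
      #{q ∈ disjointInputs U m | insert q.1.2 q.2.1 ∈ 𝒜 ∧ insert q.1.2 q.2.2 ∈ ℬ} +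
        4 * exp (-((m + 1) / 10000)) * #(disjointInputs U m) := by
  rw [card_disjointInputs_rectangle, card_disjointInputs_insert_rectangle, card_disjointInputs hU]
  exact_mod_cast sum_avoiding_le_sum_hitting hU 𝒜 ℬ

/-- The label `τ` splits the inputs satisfying `N` into combinatorial rectangles, as the transcript
of a two-party protocol does. -/
def PartitionsIntoRectangles {X Y L : Type*} (N : X → Y → Prop) (τ : X → Y → L) : Prop :=
  ∀ ⦃x y x' y'⦄, N x y → N x' y' → τ x y = τ x' y' → N x y' ∧ τ x y' = τ x y

theorem PartitionsIntoRectangles.exists_rectangle {X Y L : Type*} [Finite X] [Finite Y]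
    {N : X → Y → Prop} {τ : X → Y → L} (hτ : PartitionsIntoRectangles N τ) (l : L) :
    ∃ (𝒜 : Finset X) (ℬ : Finset Y), ∀ x y, N x y ∧ τ x y = l ↔ x ∈ 𝒜 ∧ y ∈ ℬ := by
  refine ⟨(Set.toFinite {x | ∃ y, N x y ∧ τ x y = l}).toFinset,
    (Set.toFinite {y | ∃ x, N x y ∧ τ x y = l}).toFinset, fun x y => ?_⟩
  simp only [Set.Finite.mem_toFinset, Set.mem_ofPred_eq]
  refine ⟨fun h => ⟨⟨y, h⟩, ⟨x, h⟩⟩, ?_⟩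
  rintro ⟨⟨y', hN, rfl⟩, x', hN', hl⟩
  exact hτ hN hN' hl.symm

open Classical in
theorem PartitionsIntoRectangles.card_disjointInputs_le {L : Type*} [Fintype L]
    {N : Finset U → Finset U → Prop} {τ : Finset U → Finset U → L}
    (hτ : PartitionsIntoRectangles N τ) (hU : Fintype.card U = 2 * m + 1) :
    3 / 5 * (#{q ∈ disjointInputs U m | N q.2.1 q.2.2} : ℝ) ≤
      #{q ∈ disjointInputs U m | N (insert q.1.2 q.2.1) (insert q.1.2 q.2.2)} +
        Fintype.card L * (4 * exp (-((m + 1) / 10000)) * #(disjointInputs U m)) := by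
  choose 𝒜 ℬ hrect using hτ.exists_rectangle
  rw [card_eq_sum_card_fiberwise fun q _ => mem_coe.2 (mem_univ (τ q.2.1 q.2.2)),
    card_eq_sum_card_fiberwise fun q _ =>
      mem_coe.2 (mem_univ (τ (insert q.1.2 q.2.1) (insert q.1.2 q.2.2))),
    Nat.cast_sum, Nat.cast_sum, mul_sum, ← card_univ, ← nsmul_eq_mul, ← sum_const,
    ← sum_add_distrib]
  refine sum_le_sum fun l _ => ?_
  simp only [filter_filter, hrect]
  exact corruption_bound hU (𝒜 l) (ℬ l)

open Classical in
theorem integrable_card_filter {ι Ω : Type*} [MeasurableSpace Ω] (μ : Measure Ω)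
    [IsFiniteMeasure μ] (s : Finset ι) {N : Ω → ι → Prop} (hN : ∀ i, MeasurableSet {ω | N ω i}) :
    Integrable (fun ω => (#{i ∈ s | N ω i} : ℝ)) μ := by
  simp only [natCast_card_filter]
  exact integrable_finsetSum _ fun i _ => (integrable_const 1).indicator (hN i)

open Classical in
theorem integral_card_filter {ι Ω : Type*} [MeasurableSpace Ω] (μ : Measure Ω)
    [IsFiniteMeasure μ] (s : Finset ι) {N : Ω → ι → Prop} (hN : ∀ i, MeasurableSet {ω | N ω i}) :
    ∫ ω, (#{i ∈ s | N ω i} : ℝ) ∂μ = ∑ i ∈ s, μ.real {ω | N ω i} := by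
  simp only [natCast_card_filter]
  rw [integral_finsetSum _ fun i _ => (integrable_const 1).indicator (hN i)]
  exact sum_congr rfl fun i _ => integral_indicator_one (hN i)

omit [DecidableEq U] in
theorem exp_le_card_of_partitionsIntoRectangles (hU : Fintype.card U = 2 * m + 1)
    {Ω L : Type*} [MeasurableSpace Ω] [Finite L] (μ : Measure Ω) [IsProbabilityMeasure μ]
    {N : Ω → Finset U → Finset U → Prop} {τ : Ω → Finset U → Finset U → L}
    (hN : ∀ x y, MeasurableSet {ω | N ω x y}) (hτ : ∀ ω, PartitionsIntoRectangles (N ω) (τ ω))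
    (hdisj : ∀ x y, Disjoint x y → 2 / 3 ≤ μ.real {ω | N ω x y})
    (hmeet : ∀ x y, ¬ Disjoint x y → μ.real {ω | N ω x y} ≤ 1 / 3) :
    exp ((m + 1) / 10000) ≤ 60 * Nat.card L := by
  classical
  cases nonempty_fintype L
  rw [Nat.card_eq_fintype_card]
  set s := disjointInputs U m
  have hpos : (0 : ℝ) < #s := mod_cast (disjointInputs_nonempty hU).card_pos
  have hlow : #s * (2 / 3) ≤ ∑ q ∈ s, μ.real {ω | N ω q.2.1 q.2.2} := by
    rw [← nsmul_eq_mul]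
    exact card_nsmul_le_sum _ _ _ fun q hq => hdisj _ _ (disjoint_of_mem_disjointInputs hq)
  have hhigh :
      ∑ q ∈ s, μ.real {ω | N ω (insert q.1.2 q.2.1) (insert q.1.2 q.2.2)} ≤ #s * (1 / 3) := by
    rw [← nsmul_eq_mul]
    refine sum_le_card_nsmul _ _ _ fun q _ => hmeet _ _ ?_
    exact not_disjoint_iff.2 ⟨q.1.2, mem_insert_self _ _, mem_insert_self _ _⟩
  have hmean := integral_mono (μ := μ)
    ((integrable_card_filter μ s fun q => hN q.2.1 q.2.2).const_mul (3 / 5))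
    ((integrable_card_filter μ s fun q => hN (insert q.1.2 q.2.1) (insert q.1.2 q.2.2)).add
      (integrable_const (Fintype.card L * (4 * exp (-((m + 1) / 10000)) * #s))))
    fun ω => (hτ ω).card_disjointInputs_le hU
  simp only [Pi.add_apply] at hmean
  rw [integral_const_mul, integral_add (integrable_card_filter μ s fun q => hN _ _)
    (integrable_const _), integral_const, integral_card_filter μ s fun q => hN _ _,
    integral_card_filter μ s fun q => hN _ _, probReal_univ, one_smul] at hmean
  have hlabels : 1 ≤ 60 * Fintype.card L * exp (-((m + 1) / 10000)) := by
    refine le_of_mul_le_mul_right ?_ hpos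
    linarith
  rwa [exp_neg, ← div_eq_mul_inv, one_le_div (exp_pos _)] at hlabels

end Disjointness

section TwoPartySimulation

variable {X Y V : Type*}

/-- A family of graphs on which two players can simulate a distributed algorithm: the neighbours of
the vertices of Alice (those outside `bob`) do not depend on the input `y` of Bob, and the
neighbours of the vertices in `bob` do not depend on the input `x` of Alice. -/
structure TwoPartyFamily (G : X → Y → SimpleGraph V) (bob : Set V) : Prop where
  neighborSet_alice : ∀ x y y', ∀ v ∉ bob, (G x y).neighborSet v = (G x y').neighborSet v
  neighborSet_bob : ∀ x x' y, ∀ v ∈ bob, (G x y).neighborSet v = (G x' y).neighborSet v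

/-- The pairs of a vertex of Bob and a vertex of Alice that are adjacent for some inputs. -/
def crossing (G : X → Y → SimpleGraph V) (bob : Set V) : Set (V × V) :=
  {e | e.1 ∈ bob ∧ e.2 ∉ bob ∧ ∃ x y, (G x y).Adj e.1 e.2}

theorem TwoPartyFamily.comap {V' : Type*} {G : X → Y → SimpleGraph V} {bob : Set V}
    (h : TwoPartyFamily G bob) (f : V' → V) :
    TwoPartyFamily (fun x y => (G x y).comap f) (f ⁻¹' bob) where
  neighborSet_alice x y y' v hv := congrArg (f ⁻¹' ·) (h.neighborSet_alice x y y' (f v) hv)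
  neighborSet_bob x x' y v hv := congrArg (f ⁻¹' ·) (h.neighborSet_bob x x' y (f v) hv)

theorem ncard_crossing_comap {V' : Type*} (G : X → Y → SimpleGraph V) (bob : Set V)
    (e : V' ≃ V) :
    (crossing (fun x y => (G x y).comap e) (e ⁻¹' bob)).ncard = (crossing G bob).ncard :=
  Set.ncard_preimage_of_injective_subset_range (s := crossing G bob)
    (e.injective.prodMap e.injective)
    fun p _ => ⟨(e.symm p.1, e.symm p.2), by simp only [Prod.map, e.apply_symm_apply]⟩

instance (B : ℕ) : Finite (Message B) := (List.finite_length_le Bool B).to_subtype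

theorem card_message_le (B : ℕ) : Nat.card (Message B) ≤ 2 ^ (B + 1) := by
  let split (l : Message B) : Σ k : Fin (B + 1), List.Vector Bool k :=
    ⟨⟨l.1.length, Nat.lt_succ_of_le l.2⟩, ⟨l.1, rfl⟩⟩
  have hsplit : Function.Injective split := fun l l' h =>
    Subtype.ext (congrArg (fun p : Σ k : Fin (B + 1), List.Vector Bool k => p.2.1) h)
  refine (Nat.card_le_card_of_injective split hsplit).trans ?_
  simp only [Nat.card_eq_fintype_card, Fintype.card_sigma, card_vector, Fintype.card_bool]
  rw [Fin.sum_univ_eq_sum_range (2 ^ ·)]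
  exact (Nat.geomSum_lt le_rfl fun k hk => Finset.mem_range.1 hk).le

variable {n B T : ℕ} {G : X → Y → SimpleGraph (Fin n)} {bob : Set (Fin n)}

/-- The messages sent in both directions across the pairs in `cut` during the first `T` rounds. -/
noncomputable def Algorithm.transcript (A : Algorithm n B) (cut : Set (Fin n × Fin n)) (T : ℕ)
    (seed : Fin n → A.Seed) (G : SimpleGraph (Fin n)) : Fin T → cut → Message B × Message B :=
  fun t e => (A.send (A.run G seed t e.1.1) e.1.2, A.send (A.run G seed t e.1.2) e.1.1)

theorem Algorithm.run_succ_congr (A : Algorithm n B) (seed : Fin n → A.Seed)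
    {G G' : SimpleGraph (Fin n)} {t : ℕ} {v : Fin n}
    (hadj : G.neighborSet v = G'.neighborSet v) (hstate : A.run G seed t v = A.run G' seed t v)
    (hsend : ∀ u, G.Adj v u → A.send (A.run G seed t u) v = A.send (A.run G' seed t u) v) :
    A.run G seed (t + 1) v = A.run G' seed (t + 1) v := by
  have hadj (u : Fin n) : G.Adj u v ↔ G'.Adj u v := by
    rw [G.adj_comm, G'.adj_comm, ← SimpleGraph.mem_neighborSet, hadj, SimpleGraph.mem_neighborSet]
  refine congrArg₂ A.step hstate (funext fun u => ?_)
  by_cases hu : G.Adj u v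
  · rw [if_pos hu, if_pos ((hadj u).1 hu), hsend u hu.symm]
  · rw [if_neg hu, if_neg (hu ∘ (hadj u).2)]

theorem TwoPartyFamily.run_mixed (h : TwoPartyFamily G bob) (A : Algorithm n B)
    {seed : Fin n → A.Seed} {x x' : X} {y y' : Y}
    (hτ : A.transcript (crossing G bob) T seed (G x y) =
      A.transcript (crossing G bob) T seed (G x' y')) {t : ℕ} (ht : t ≤ T) :
    (∀ v ∉ bob, A.run (G x y') seed t v = A.run (G x y) seed t v) ∧
      ∀ v ∈ bob, A.run (G x y') seed t v = A.run (G x' y') seed t v := by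
  induction t with
  | zero =>
    exact ⟨fun v hv => congrArg (A.start v · (seed v)) (h.neighborSet_alice x y' y v hv),
      fun v hv => congrArg (A.start v · (seed v)) (h.neighborSet_bob x x' y' v hv)⟩
  | succ t ih =>
    obtain ⟨halice, hbob⟩ := ih (Nat.le_of_succ_le ht)
    have hmsg (u v : Fin n) (hu : u ∈ bob) (hv : v ∉ bob) (huv : (G x y').Adj u v) :=
      Prod.ext_iff.1 (congrFun₂ hτ ⟨t, ht⟩ ⟨(u, v), hu, hv, x, y', huv⟩)
    constructor <;> intro v hv
    · refine A.run_succ_congr seed (h.neighborSet_alice x y' y v hv) (halice v hv) fun u hvu => ?_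
      by_cases hu : u ∈ bob
      · rw [hbob u hu]
        exact (hmsg u v hu hv hvu.symm).1.symm
      · rw [halice u hu]
    · refine A.run_succ_congr seed (h.neighborSet_bob x x' y' v hv) (hbob v hv) fun u hvu => ?_
      by_cases hu : u ∈ bob
      · rw [hbob u hu]
      · rw [halice u hu]
        exact (hmsg v u hv hu hvu).2

theorem TwoPartyFamily.partitionsIntoRectangles (h : TwoPartyFamily G bob) (A : Algorithm n B)
    (T : ℕ) (seed : Fin n → A.Seed) :
    PartitionsIntoRectangles (fun x y => ¬ A.Accepts (G x y) T seed)
      fun x y => A.transcript (crossing G bob) T seed (G x y) := by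
  intro x y x' y' hN hN' hτ
  constructor
  · rintro ⟨v, hv⟩
    obtain ⟨halice, hbob⟩ := h.run_mixed A hτ le_rfl
    by_cases hvb : v ∈ bob
    · exact hN' ⟨v, hbob v hvb ▸ hv⟩
    · exact hN ⟨v, halice v hvb ▸ hv⟩
  · funext t ⟨(u, v), hu, hv, _⟩
    obtain ⟨halice, hbob⟩ := h.run_mixed A hτ t.2.le
    refine Prod.ext ?_ ?_
    · simp only [Algorithm.transcript, hbob u hu]
      exact congrArg Prod.fst (congrFun₂ hτ t ⟨(u, v), hu, hv, ‹_›⟩).symm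
    · simp only [Algorithm.transcript, halice v hv]

theorem card_transcript_le (B T : ℕ) {E : Type*} [Finite E] :
    Nat.card (Fin T → E → Message B × Message B) ≤ 2 ^ (2 * (B + 1) * Nat.card E * T) := by
  cases nonempty_fintype E
  rw [Nat.card_pi, Finset.prod_const, Finset.card_univ, Fintype.card_fin, Nat.card_pi,
    Finset.prod_const, Finset.card_univ, Nat.card_prod, ← sq, pow_mul, pow_mul, mul_comm 2, pow_mul,
    Nat.card_eq_fintype_card (α := E)]
  gcongr
  exact card_message_le B

theorem TwoPartyFamily.exp_le_of_decidesIn {U : Type*} [Fintype U] {m : ℕ}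
    (hU : Fintype.card U = 2 * m + 1) {G : Finset U → Finset U → SimpleGraph (Fin n)}
    (h : TwoPartyFamily G bob) (hconn : ∀ x y, (G x y).Connected)
    {P : SimpleGraph (Fin n) → Prop} (hP : ∀ x y, P (G x y) ↔ ¬ Disjoint x y)
    {A : Algorithm n B} (hA : A.DecidesIn P T) :
    Real.exp ((m + 1) / 10000) ≤ 60 * 2 ^ (2 * (B + 1) * (crossing G bob).ncard * T) := by
  let := A.seedSpace
  have := A.law_prob
  have hdecides (x y) : MeasurableSet {seed | A.Accepts (G x y) T seed ↔ ¬ Disjoint x y} ∧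
      2 / 3 ≤ A.law.real {seed | A.Accepts (G x y) T seed ↔ ¬ Disjoint x y} := by
    rw [← hP]
    exact hA (G x y) (hconn x y)
  have hcompl (x y) (hxy : ¬ Disjoint x y) : {seed | ¬ A.Accepts (G x y) T seed} =
      {seed | A.Accepts (G x y) T seed ↔ ¬ Disjoint x y}ᶜ := by
    simp only [hxy, not_false_eq_true, iff_true]
    rfl
  refine (exp_le_card_of_partitionsIntoRectangles hU A.law ?_
    (h.partitionsIntoRectangles A T) ?_ ?_).trans ?_
  · intro x y
    by_cases hxy : Disjoint x y
    · simpa only [hxy, not_true, iff_false] using (hdecides x y).1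
    · exact hcompl x y hxy ▸ (hdecides x y).1.compl
  · intro x y hxy
    simpa only [hxy, not_true, iff_false] using (hdecides x y).2
  · intro x y hxy
    rw [hcompl x y hxy, probReal_compl_eq_one_sub (hdecides x y).1]
    linarith [(hdecides x y).2]
  · gcongr
    exact_mod_cast card_transcript_le B T (E := crossing G bob)

end TwoPartySimulation

section CliqueCover

variable {W : Type*} {H : SimpleGraph W} {k : ℕ}

/-- A family of `k`-colourable vertex sets such that every `k`-clique of `H` lies inside a member of
the family. Cliques are encoded as homomorphisms from the complete graph, which are injective. -/
structure IsCliqueCover (H : SimpleGraph W) (k : ℕ) (𝒞 : Finset (Set W)) : Prop where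
  colorable : ∀ C ∈ 𝒞, (H.induce C).Colorable k
  exists_mem : ∀ κ : (⊤ : SimpleGraph (Fin k)) →g H, ∃ C ∈ 𝒞, ∀ i, κ i ∈ C

theorem colorable_induce_range {V : Type*} [Fintype V] (κ : (⊤ : SimpleGraph V) →g H) :
    (H.induce (Set.range κ)).Colorable (Fintype.card V) := by
  choose i hi using fun a : Set.range κ => a.2
  refine (SimpleGraph.Coloring.mk i fun {a b} hab hi' => hab.ne ?_).colorable
  rw [← Subtype.coe_inj, ← hi a, hi', hi b]

theorem exists_isCliqueCover [Finite W] (H : SimpleGraph W) (k : ℕ) :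
    ∃ 𝒞, IsCliqueCover H k 𝒞 := by
  refine ⟨(Set.toFinite (Set.range fun κ : (⊤ : SimpleGraph (Fin k)) →g H =>
    Set.range κ)).toFinset, fun C hC => ?_, fun κ => ⟨Set.range κ, ?_, Set.mem_range_self⟩⟩
  · obtain ⟨κ, rfl⟩ := (Set.Finite.mem_toFinset _).1 hC
    simpa only [Fintype.card_fin] using colorable_induce_range κ
  · exact (Set.Finite.mem_toFinset _).2 ⟨κ, rfl⟩

theorem exists_minimum_isCliqueCover [Finite W] (hH : ¬ H.CliqueFree k) :
    ∃ 𝒞, IsCliqueCover H k 𝒞 ∧ (∀ 𝒟, IsCliqueCover H k 𝒟 → 𝒞.card ≤ 𝒟.card) ∧ 𝒞.Nonempty := by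
  obtain ⟨𝒞, h𝒞, hmin⟩ := exists_minimalFor_of_wellFoundedLT (IsCliqueCover H k) Finset.card
    (exists_isCliqueCover H k)
  obtain ⟨κ⟩ := (SimpleGraph.not_cliqueFree_iff_top_isContained k).1 hH
  obtain ⟨C, hC, -⟩ := h𝒞.exists_mem κ.toHom
  exact ⟨𝒞, h𝒞, fun 𝒟 h𝒟 => (le_total _ _).elim id (hmin h𝒟), C, hC⟩

/-- Otherwise no clique of `K` projects into `C`, and the pullbacks of the members other than `C`
along `φ` form a smaller clique cover of `H`. -/
theorem IsCliqueCover.exists_hom_mem {V V' : Type*} {G : SimpleGraph V} {K : SimpleGraph V'}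
    {𝒞 : Finset (Set W)} (h𝒞 : IsCliqueCover H k 𝒞)
    (hmin : ∀ 𝒟, IsCliqueCover H k 𝒟 → 𝒞.card ≤ 𝒟.card) {C : Set W} (hC : C ∈ 𝒞)
    (φ : H →g G) (ι : K ↪g G) (π : K →g H)
    (hι : ∀ (κ : (⊤ : SimpleGraph (Fin k)) →g G) i, κ i ∈ Set.range ι) :
    ∃ κ : (⊤ : SimpleGraph (Fin k)) →g K, ∀ i, π (κ i) ∈ C := by
  classical
  by_contra! hno
  let pull (D : Set W) : Set W := {w | ∃ a, ι a = φ w ∧ π a ∈ D}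
  suffices hpull : IsCliqueCover H k ((𝒞.erase C).image pull) from
    (hmin _ hpull).not_gt (Finset.card_image_le.trans_lt (Finset.card_erase_lt_of_mem hC))
  refine ⟨fun D' hD' => ?_, fun κ => ?_⟩
  · obtain ⟨D, hD, rfl⟩ := Finset.mem_image.1 hD'
    choose a ha haD using fun w : pull D => w.2
    let proj : H.induce (pull D) →g H.induce D :=
      ⟨fun w => ⟨π (a w), haD w⟩, fun {v w} hvw => π.map_adj <| ι.map_adj_iff.1 <| by
        rw [ha, ha]
        exact φ.map_adj hvw⟩
    exact (h𝒞.colorable D (Finset.mem_of_mem_erase hD)).of_hom proj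
  · choose a ha using hι (φ.comp κ)
    let lift : (⊤ : SimpleGraph (Fin k)) →g K :=
      ⟨a, fun {i j} hij => ι.map_adj_iff.1 <| by
        rw [ha, ha]
        exact (φ.comp κ).map_adj hij⟩
    obtain ⟨D, hD, hliftD⟩ := h𝒞.exists_mem (π.comp lift)
    obtain ⟨i, hi⟩ := hno lift
    have hDC : D ≠ C := fun h => hi (h ▸ hliftD i)
    exact ⟨pull D, Finset.mem_image_of_mem _ (Finset.mem_erase.2 ⟨hDC, hD⟩),
      fun i => ⟨a i, ha i, hliftD i⟩⟩

theorem exists_coloring_on_of_colorable_induce [NeZero k] {C : Set W}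
    (hC : (H.induce C).Colorable k) :
    ∃ col : W → Fin k, ∀ v ∈ C, ∀ w ∈ C, H.Adj v w → col v ≠ col w := by
  classical
  obtain ⟨c⟩ := hC
  refine ⟨fun w => if hw : w ∈ C then c ⟨w, hw⟩ else 0, fun v hv w hw hvw => ?_⟩
  simp only [dif_pos hv, dif_pos hw]
  exact c.valid (v := ⟨v, hv⟩) (w := ⟨w, hw⟩) hvw

end CliqueCover

section BlowUp

variable {W E P : Type*}

/-- Every vertex `w` of `H` is replaced by the copies `(w, p)`, and every element `e` of the ground
set of the disjointness instance selects the copy `pos w e` of each `w`. Copies of adjacent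
vertices are joined if they are selected by a common element, which must moreover belong to `x` if
both are on the side of Alice, and to `y` if both are on the side of Bob. -/
def blowUp (H : SimpleGraph W) (pos : W → E → P) (bob : Set W) (x y : Finset E) :
    SimpleGraph (W × P) where
  Adj a b := H.Adj a.1 b.1 ∧ ∃ e, pos a.1 e = a.2 ∧ pos b.1 e = b.2 ∧
    (a.1 ∉ bob ∧ b.1 ∉ bob → e ∈ x) ∧ (a.1 ∈ bob ∧ b.1 ∈ bob → e ∈ y)
  symm := ⟨fun _ _ ⟨hab, e, ha, hb, hx, hy⟩ => ⟨hab.symm, e, hb, ha, hx ∘ And.symm, hy ∘ And.symm⟩⟩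
  loopless := ⟨fun a h => H.loopless.irrefl a.1 h.1⟩

variable (H : SimpleGraph W) (pos : W → E → P) (bob : Set W)

/-- The projection of the blow-up to the pattern. -/
def blowUpProj (x y : Finset E) : blowUp H pos bob x y →g H := ⟨Prod.fst, And.left⟩

theorem isIndContained_blowUp {x y : Finset E} (h : ¬ Disjoint x y) :
    H.IsIndContained (blowUp H pos bob x y) := by
  obtain ⟨e, hx, hy⟩ := Finset.not_disjoint_iff.1 h
  exact ⟨⟨⟨fun w => (w, pos w e), fun v w h => congrArg Prod.fst h⟩,
    ⟨And.left, fun hvw => ⟨hvw, e, rfl, rfl, fun _ => hx, fun _ => hy⟩⟩⟩⟩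

theorem twoPartyFamily_blowUp :
    TwoPartyFamily (blowUp H pos bob) {a | a.1 ∈ bob} where
  neighborSet_alice x y y' v hv := by
    ext u
    simp only [SimpleGraph.mem_neighborSet, blowUp, show v.1 ∉ bob from hv, false_and,
      false_imp_iff]
  neighborSet_bob x x' y v hv := by
    ext u
    simp only [SimpleGraph.mem_neighborSet, blowUp, show v.1 ∈ bob from hv, not_true, false_and,
      false_imp_iff]

theorem ncard_crossing_blowUp_le [Fintype W] [Finite E] {M : ℕ}
    (hM : ∀ v ∈ bob, ∀ w ∉ bob, (Set.range fun e => (pos v e, pos w e)).ncard ≤ M) :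
    (crossing (blowUp H pos bob) {a | a.1 ∈ bob}).ncard ≤ Fintype.card W ^ 2 * M := by
  classical
  let copies (r : W × W) : Set ((W × P) × (W × P)) := if r.1 ∈ bob ∧ r.2 ∉ bob then
    (fun p : P × P => ((r.1, p.1), (r.2, p.2))) '' Set.range fun e => (pos r.1 e, pos r.2 e) else ∅
  have hcopies (r : W × W) : (copies r).Finite ∧ (copies r).ncard ≤ M := by
    by_cases hr : r.1 ∈ bob ∧ r.2 ∉ bob
    · simp only [copies, if_pos hr]
      exact ⟨(Set.finite_range _).image _,
        (Set.ncard_image_le (Set.finite_range _)).trans (hM _ hr.1 _ hr.2)⟩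
    · simp only [copies, if_neg hr, Set.finite_empty, Set.ncard_empty, zero_le, and_self]
  have hsub : crossing (blowUp H pos bob) {a | a.1 ∈ bob} ⊆ ⋃ r, copies r := by
    rintro e ⟨hv, hw, x, y, -, f, hpv, hpw, -⟩
    refine Set.mem_iUnion.2 ⟨(e.1.1, e.2.1), ?_⟩
    simp only [copies]
    rw [if_pos ⟨hv, hw⟩]
    exact ⟨_, ⟨f, rfl⟩, by simp only [hpv, hpw]⟩
  calc (crossing (blowUp H pos bob) {a | a.1 ∈ bob}).ncard
      ≤ (⋃ r, copies r).ncard :=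
        Set.ncard_le_ncard hsub (Set.finite_iUnion fun r => (hcopies r).1)
    _ ≤ ∑ r, (copies r).ncard := Set.ncard_iUnion_le_of_fintype copies
    _ ≤ Fintype.card (W × W) • M := Finset.sum_le_card_nsmul _ _ _ fun r _ => (hcopies r).2
    _ = Fintype.card W ^ 2 * M := by rw [Fintype.card_prod, sq, smul_eq_mul]

end BlowUp

section Gadget

variable {Q : Type*}

/-- The ground set of the disjointness instance encoded into the network: an element
`((i, j), (k, l))` is an edge between the nodes `(i, j)` and `(k, l)` of two copies of `Q × Q`. -/
abbrev Element (Q : Type*) : Type _ := (Q × Q) × (Q × Q)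

/-- The nodes selected by an element in the four colour classes. The colours `0` and `1` are played
by Alice, `2` and `3` by Bob. A node of Alice and a node of Bob always share exactly one of the
coordinates, so that there are few edges between the players. -/
def position : Fin 4 → Element Q → Q × Q
  | 0, e => (e.1.1, e.1.2)
  | 1, e => (e.2.1, e.2.2)
  | 2, e => (e.1.1, e.2.1)
  | 3, e => (e.1.2, e.2.2)

theorem ncard_range_le_card {α β γ : Type*} [Finite γ] {f : α → β} (g : α → γ) (h : γ → β)
    (hf : ∀ a, f a = h (g a)) : (Set.range f).ncard ≤ Nat.card γ := calc
  (Set.range f).ncard ≤ (Set.range h).ncard :=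
    Set.ncard_le_ncard (Set.range_subset_iff.2 fun a => ⟨g a, (hf a).symm⟩) (Set.finite_range h)
  _ ≤ Nat.card γ := Finite.card_range_le h

theorem ncard_range_position_le [Finite Q] {c d : Fin 4} (hc : 2 ≤ c) (hd : ¬ 2 ≤ d) :
    (Set.range fun e : Element Q => (position c e, position d e)).ncard ≤ Nat.card Q ^ 3 := by
  have hcard : Nat.card (Q × Q × Q) = Nat.card Q ^ 3 := by
    rw [Nat.card_prod, Nat.card_prod]
    ring
  rw [← hcard]
  obtain rfl | rfl : d = 0 ∨ d = 1 := by omega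
  all_goals obtain rfl | rfl : c = 2 ∨ c = 3 := by omega
  · exact ncard_range_le_card (fun e => (e.1.1, e.1.2, e.2.1))
      (fun t => ((t.1, t.2.2), (t.1, t.2.1))) fun _ => rfl
  · exact ncard_range_le_card (fun e => (e.1.1, e.1.2, e.2.2))
      (fun t => ((t.2.1, t.2.2), (t.1, t.2.1))) fun _ => rfl
  · exact ncard_range_le_card (fun e => (e.1.1, e.2.1, e.2.2))
      (fun t => ((t.1, t.2.1), (t.2.1, t.2.2))) fun _ => rfl
  · exact ncard_range_le_card (fun e => (e.1.2, e.2.1, e.2.2))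
      (fun t => ((t.1, t.2.2), (t.2.1, t.2.2))) fun _ => rfl

variable {W : Type*} {H : SimpleGraph W} (col : W → Fin 4)

/-- The blow-up of `H` with the nodes of each colour selected according to `position`. -/
abbrev colorBlowUp (H : SimpleGraph W) (col : W → Fin 4) :
    Finset (Element Q) → Finset (Element Q) → SimpleGraph (W × (Q × Q)) :=
  blowUp H (fun w => position (col w)) {w | 2 ≤ col w}

/-- A 4-clique in all four colours forces the edge of Alice between the colours `0` and `1` and the
edge of Bob between the colours `2` and `3` to come from the same element. -/
theorem not_disjoint_of_hom_colorBlowUp {x y : Finset (Element Q)}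
    (κ : (⊤ : SimpleGraph (Fin 4)) →g colorBlowUp H col x y)
    (hκ : Pairwise fun i j => col (κ i).1 ≠ col (κ j).1) : ¬ Disjoint x y := by
  have hbij : Function.Bijective fun i => col (κ i).1 :=
    Finite.injective_iff_bijective.1 (Function.injective_iff_pairwise_ne.2 hκ)
  choose v hv using hbij.surjective
  have hjoin (c d : Fin 4) (hcd : c ≠ d) : ∃ e, position c e = (κ (v c)).2 ∧
      position d e = (κ (v d)).2 ∧ (¬ 2 ≤ c ∧ ¬ 2 ≤ d → e ∈ x) ∧ (2 ≤ c ∧ 2 ≤ d → e ∈ y) := by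
    have hadj := κ.map_adj (show (⊤ : SimpleGraph (Fin 4)).Adj (v c) (v d) from
      fun h => hcd (by rw [← hv c, ← hv d, h]))
    obtain ⟨e, he⟩ := hadj.2
    have hc : col (κ (v c)).1 = c := hv c
    have hd : col (κ (v d)).1 = d := hv d
    simp only [Set.mem_ofPred_eq, hc, hd] at he
    exact ⟨e, he⟩
  obtain ⟨e, he₀, he₁, hex, -⟩ := hjoin 0 1 (by decide)
  obtain ⟨f, hf₂, hf₃, -, hfy⟩ := hjoin 2 3 (by decide)
  obtain ⟨g₀₂, h₀₂, h₂₀, -⟩ := hjoin 0 2 (by decide)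
  obtain ⟨g₀₃, h₀₃, h₃₀, -⟩ := hjoin 0 3 (by decide)
  obtain ⟨g₁₂, h₁₂, h₂₁, -⟩ := hjoin 1 2 (by decide)
  obtain ⟨g₁₃, h₁₃, h₃₁, -⟩ := hjoin 1 3 (by decide)
  have hef : e = f := by
    simp only [position, Prod.ext_iff] at *
    grind
  exact Finset.not_disjoint_iff.2 ⟨e, hex (by decide), hef ▸ hfy (by decide)⟩

end Gadget

section Padding

variable {V R : Type*}

/-- The graph `K` with a pendant vertex attached to each vertex, where all pendant vertices are
joined to all vertices of `R`. This makes the graph connected and gives it the desired number of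
vertices, without creating new triangles. -/
def padded (K : SimpleGraph V) (R : Type*) : SimpleGraph (V ⊕ (V ⊕ R)) where
  Adj
    | .inl a, .inl b => K.Adj a b
    | .inl a, .inr (.inl b) => a = b
    | .inr (.inl a), .inl b => a = b
    | .inr (.inl _), .inr (.inr _) => True
    | .inr (.inr _), .inr (.inl _) => True
    | _, _ => False
  symm := ⟨by rintro (_ | _ | _) (_ | _ | _) <;> simp only [K.adj_comm, eq_comm, imp_self]⟩
  loopless := ⟨by rintro (_ | _ | _) <;> simp only [K.irrefl, not_false_eq_true]⟩

/-- The inclusion of a graph into its padding. -/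
def paddedInl (K : SimpleGraph V) (R : Type*) : K ↪g padded K R := ⟨.inl, Iff.rfl⟩

theorem connected_padded [Nonempty V] [Nonempty R] (K : SimpleGraph V) :
    (padded K R).Connected := by
  obtain ⟨r₀⟩ := ‹Nonempty R›
  have hpendant (a : V) : (padded K R).Reachable (.inr (.inl a)) (.inr (.inr r₀)) :=
    SimpleGraph.Adj.reachable (G := padded K R) trivial
  refine SimpleGraph.connected_iff_exists_forall_reachable _ |>.2 ⟨.inr (.inr r₀), ?_⟩
  rintro (a | a | r)
  · exact (hpendant a).symm.trans (SimpleGraph.Adj.reachable (G := padded K R) (Eq.refl a))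
  · exact (hpendant a).symm
  · obtain ⟨a⟩ := ‹Nonempty V›
    exact (hpendant a).symm.trans (SimpleGraph.Adj.reachable (G := padded K R) trivial)

theorem mem_range_paddedInl_of_triangle {K : SimpleGraph V} {a b c : V ⊕ (V ⊕ R)}
    (hab : (padded K R).Adj a b) (hac : (padded K R).Adj a c) (hbc : (padded K R).Adj b c) :
    a ∈ Set.range (paddedInl K R) := by
  rcases a with a | a | a
  · exact ⟨a, rfl⟩
  all_goals
    rcases b with b | b | b <;> rcases c with c | c | c <;> simp_all [padded]

theorem mem_range_paddedInl_of_clique {K : SimpleGraph V} {k : ℕ} (hk : 3 ≤ k)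
    (κ : (⊤ : SimpleGraph (Fin k)) →g padded K R) (i : Fin k) :
    κ i ∈ Set.range (paddedInl K R) := by
  have hcard : 1 < (Finset.univ.erase i).card := by
    rw [Finset.card_erase_of_mem (Finset.mem_univ i), Finset.card_univ, Fintype.card_fin]
    omega
  obtain ⟨j, hj, l, hl, hjl⟩ := Finset.one_lt_card.1 hcard
  exact mem_range_paddedInl_of_triangle (κ.map_adj (Finset.ne_of_mem_erase hj).symm)
    (κ.map_adj (Finset.ne_of_mem_erase hl).symm) (κ.map_adj hjl)

variable {X Y : Type*} {K : X → Y → SimpleGraph V} {bob : Set V}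

theorem TwoPartyFamily.padded (h : TwoPartyFamily K bob) (R : Type*) :
    TwoPartyFamily (fun x y => padded (K x y) R) (.inl '' bob) where
  neighborSet_alice x y y' v hv := by
    ext u
    rcases v with v | v
    · rcases u with u | u
      · exact Set.ext_iff.1 (h.neighborSet_alice x y y' v fun hvb => hv ⟨v, hvb, rfl⟩) u
      · cases u <;> rfl
    · rcases u with u | u <;> cases v <;> try cases u
      all_goals rfl
  neighborSet_bob x x' y v hv := by
    obtain ⟨v, hvb, rfl⟩ := hv
    ext u
    rcases u with u | u | u
    · exact Set.ext_iff.1 (h.neighborSet_bob x x' y v hvb) u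
    all_goals rfl

theorem ncard_crossing_padded_le [Fintype V] (K : X → Y → SimpleGraph V) (bob : Set V)
    (R : Type*) :
    (crossing (fun x y => padded (K x y) R) (.inl '' bob)).ncard ≤
      (crossing K bob).ncard + Fintype.card V := by
  let pendant (a : V) : (V ⊕ (V ⊕ R)) × (V ⊕ (V ⊕ R)) := (.inl a, .inr (.inl a))
  have hsub : crossing (fun x y => padded (K x y) R) (.inl '' bob) ⊆
      Prod.map .inl .inl '' crossing K bob ∪ Set.range pendant := by
    rintro ⟨_, v | v | v⟩ ⟨⟨u, hu, rfl⟩, hv, x, y, huv⟩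
    · exact .inl ⟨(u, v), ⟨hu, fun hvb => hv ⟨v, hvb, rfl⟩, x, y, huv⟩, rfl⟩
    · obtain rfl : u = v := huv
      exact .inr ⟨u, rfl⟩
    · exact huv.elim
  calc _ ≤ (Prod.map .inl .inl '' crossing K bob ∪ Set.range pendant).ncard :=
        Set.ncard_le_ncard hsub (.union (.image _ (Set.toFinite _)) (Set.finite_range _))
    _ ≤ _ := Set.ncard_union_le _ _
    _ ≤ (crossing K bob).ncard + Fintype.card V :=
      add_le_add (Set.ncard_image_le (Set.toFinite _))
        (Nat.card_eq_fintype_card (α := V) ▸ Finite.card_range_le pendant)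

end Padding

section LowerBound

variable {W : Type*} {H : SimpleGraph W}

theorem exists_coloring_forall_not_disjoint [Finite W] {Q : Type*}
    (hH : ¬ H.CliqueFree 4) :
    ∃ col : W → Fin 4, ∀ (R : Type) (x y : Finset (Element Q)),
      H.IsContained (padded (colorBlowUp H col x y) R) → ¬ Disjoint x y := by
  obtain ⟨𝒞, h𝒞, hmin, C, hC⟩ := exists_minimum_isCliqueCover hH
  obtain ⟨col, hcol⟩ := exists_coloring_on_of_colorable_induce (h𝒞.colorable C hC)
  refine ⟨col, fun R x y ⟨φ⟩ => ?_⟩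
  obtain ⟨κ, hκ⟩ := h𝒞.exists_hom_mem hmin hC φ.toHom (paddedInl _ R)
    (blowUpProj H _ _ x y) (mem_range_paddedInl_of_clique (by norm_num))
  exact not_disjoint_of_hom_colorBlowUp col κ fun i j hij =>
    hcol _ (hκ i) _ (hκ j) (κ.map_adj hij).1

variable [Fintype W]

theorem ncard_crossing_padded_colorBlowUp_le (H : SimpleGraph W) (col : W → Fin 4) {q : ℕ}
    (hq : 0 < q) (R : Type*) :
    (crossing (fun x y => padded (colorBlowUp (Q := Fin q) H col x y) R)
      (.inl '' {a | 2 ≤ col a.1})).ncard ≤ 2 * Fintype.card W ^ 2 * q ^ 3 := by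
  have hM := ncard_crossing_blowUp_le H (fun w => position (Q := Fin q) (col w)) {w | 2 ≤ col w}
    fun v hv w hw => ncard_range_position_le hv hw
  rw [Nat.card_eq_fintype_card, Fintype.card_fin] at hM
  calc _ ≤ _ + Fintype.card (W × (Fin q × Fin q)) := ncard_crossing_padded_le _ _ R
    _ ≤ Fintype.card W ^ 2 * q ^ 3 + Fintype.card W ^ 2 * q ^ 3 := by
        refine add_le_add hM ?_
        rw [Fintype.card_prod, Fintype.card_prod, Fintype.card_fin, ← sq]
        gcongr
        · exact Nat.le_self_pow two_ne_zero _
        · norm_num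
    _ = 2 * Fintype.card W ^ 2 * q ^ 3 := by ring

theorem exists_twoPartyFamily [Nonempty W] (hH : ¬ H.CliqueFree 4) {q n : ℕ} (hq : 0 < q)
    (hn : 2 * (Fintype.card W * q ^ 2) < n) :
    ∃ (G : Finset (Element (Fin q)) → Finset (Element (Fin q)) → SimpleGraph (Fin n))
      (bob : Set (Fin n)), TwoPartyFamily G bob ∧
      (crossing G bob).ncard ≤ 2 * Fintype.card W ^ 2 * q ^ 3 ∧
      ∀ x y, (G x y).Connected ∧ (¬ Disjoint x y → H.IsIndContained (G x y)) ∧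
        (H.IsContained (G x y) → ¬ Disjoint x y) := by
  obtain ⟨col, hcol⟩ := exists_coloring_forall_not_disjoint (Q := Fin q) hH
  let R := Fin (n - 2 * (Fintype.card W * q ^ 2))
  have : Nonempty R := ⟨⟨0, by omega⟩⟩
  have : Nonempty (Fin q) := ⟨⟨0, hq⟩⟩
  have hcard : Fintype.card (Fin n) =
      Fintype.card ((W × (Fin q × Fin q)) ⊕ ((W × (Fin q × Fin q)) ⊕ R)) := by
    simp only [Fintype.card_sum, Fintype.card_prod, Fintype.card_fin, R, ← sq]
    omega
  let e := Fintype.equivOfCardEq hcard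
  let K (x y : Finset (Element (Fin q))) := padded (colorBlowUp H col x y) R
  have iso (x y) : (K x y).comap e ≃g K x y := SimpleGraph.Iso.comap e (K x y)
  refine ⟨fun x y => (K x y).comap e, e ⁻¹' (.inl '' {a | 2 ≤ col a.1}),
    ((twoPartyFamily_blowUp H _ _).padded R).comap e, ?_, fun x y => ⟨?_, fun hxy => ?_, ?_⟩⟩
  · exact (ncard_crossing_comap K _ e).trans_le (ncard_crossing_padded_colorBlowUp_le H col hq R)
  · exact (iso x y).connected_iff.2 (connected_padded _)
  · obtain ⟨f⟩ := isIndContained_blowUp H (fun w => position (col w)) {w | 2 ≤ col w} hxy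
    exact ⟨(iso x y).symm.toEmbedding.comp ((paddedInl _ R).comp f)⟩
  · exact fun ⟨f⟩ => hcol R x y ⟨(iso x y).toEmbedding.toCopy.comp f⟩

theorem exp_le_of_decidesIn [Nonempty W] (hH : ¬ H.CliqueFree 4) {q n B T : ℕ} (hq : Odd q)
    (hn : 2 * (Fintype.card W * q ^ 2) < n) {P : SimpleGraph (Fin n) → Prop}
    (hInd : ∀ G, H.IsIndContained G → P G) (hSub : ∀ G, P G → H.IsContained G)
    {A : Algorithm n B} (hA : A.DecidesIn P T) :
    Real.exp ((q : ℝ) ^ 4 / 20000) ≤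
      60 * 2 ^ (4 * Fintype.card W ^ 2 * q ^ 3 * ((B + 1) * T)) := by
  obtain ⟨G, bob, hG, hcut, hGP⟩ := exists_twoPartyFamily hH hq.pos hn
  obtain ⟨m, hm⟩ : Odd (q ^ 4) := hq.pow
  have hU : Fintype.card (Element (Fin q)) = 2 * m + 1 := by
    simp only [Fintype.card_prod, Fintype.card_fin, ← hm]
    ring
  have hq4 : (q : ℝ) ^ 4 = 2 * m + 1 := mod_cast hm
  calc Real.exp ((q : ℝ) ^ 4 / 20000) ≤ Real.exp ((m + 1) / 10000) := by
        rw [Real.exp_le_exp, hq4]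
        linarith
    _ ≤ 60 * 2 ^ (2 * (B + 1) * (crossing G bob).ncard * T) :=
        hG.exp_le_of_decidesIn hU (fun x y => (hGP x y).1)
          (fun x y => ⟨fun hP => (hGP x y).2.2 (hSub _ hP), fun hxy => hInd _ ((hGP x y).2.1 hxy)⟩)
          hA
    _ ≤ 60 * 2 ^ (2 * (B + 1) * (2 * Fintype.card W ^ 2 * q ^ 3) * T) := by
        gcongr
        norm_num
    _ = 60 * 2 ^ (4 * Fintype.card W ^ 2 * q ^ 3 * ((B + 1) * T)) := by ring_nf

theorem exists_odd_sq_mul_lt {w n : ℕ} (hw : 0 < w) (hn : 32 * w ≤ n) :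
    ∃ q, Odd q ∧ 2 * (w * q ^ 2) < n ∧ n ≤ 32 * w * q ^ 2 := by
  have hw32 : 0 < 32 * w := by positivity
  set p := Nat.sqrt (n / (32 * w))
  have hp : 1 ≤ p := Nat.le_sqrt.2 ((Nat.le_div_iff_mul_le hw32).2 (by simpa using hn))
  have hlow : p * p * (32 * w) ≤ n := (Nat.le_div_iff_mul_le hw32).1 (Nat.sqrt_le _)
  have hhigh : n < (p + 1) * (p + 1) * (32 * w) :=
    (Nat.div_lt_iff_lt_mul hw32).1 (Nat.lt_succ_sqrt _)
  refine ⟨2 * p + 1, odd_two_mul_add_one p, lt_of_lt_of_le ?_ hlow, hhigh.le.trans ?_⟩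
  · calc 2 * (w * (2 * p + 1) ^ 2) ≤ 2 * (w * (3 * p) ^ 2) := by
          gcongr
          omega
      _ = 18 * (w * p ^ 2) := by ring
      _ < 32 * (w * p ^ 2) := by
          gcongr
          norm_num
      _ = p * p * (32 * w) := by ring
  · rw [← sq, mul_comm]
    gcongr
    omega

theorem le_of_exp_pow_four_le {w q N : ℕ} (hq : 40 ≤ q)
    (h : Real.exp ((q : ℝ) ^ 4 / 20000) ≤ 60 * 2 ^ (4 * w ^ 2 * q ^ 3 * N)) :
    (q : ℝ) ≤ 160000 * w ^ 2 * N := by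
  have hlog : (q : ℝ) ^ 4 / 20000 ≤ 59 + 4 * w ^ 2 * q ^ 3 * N := by
    rw [← Real.exp_le_exp, Real.exp_add]
    refine h.trans ?_
    gcongr
    · linarith [Real.add_one_le_exp 59]
    · calc (2 : ℝ) ^ (4 * w ^ 2 * q ^ 3 * N) ≤ Real.exp 1 ^ (4 * w ^ 2 * q ^ 3 * N) := by
            gcongr
            linarith [Real.add_one_le_exp 1]
        _ = Real.exp (4 * w ^ 2 * q ^ 3 * N) := by
            rw [← Real.exp_nat_mul, mul_one]
            push_cast
            rfl
  have hq' : (40 : ℝ) ≤ q := mod_cast hq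
  have hbig : (40 : ℝ) ^ 4 ≤ (q : ℝ) ^ 4 := by gcongr
  have hq3 : (0 : ℝ) < (q : ℝ) ^ 3 := by positivity
  refine le_of_mul_le_mul_left ?_ hq3
  linarith

theorem mul_sqrt_div_log_le {n B T : ℕ} {b c : ℝ} (hn : 3 ≤ n) (hB : B ≤ b * Real.log n)
    (h : c * √n ≤ (B + 1) * T) : c / (|b| + 1) * (√n / Real.log n) ≤ T := by
  have hn : (3 : ℝ) ≤ n := mod_cast hn
  have hlog : 1 ≤ Real.log n := by
    rw [Real.le_log_iff_exp_le (by linarith)]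
    linarith [Real.exp_one_lt_d9]
  have hBlog : (B + 1 : ℝ) ≤ (|b| + 1) * Real.log n := by
    linarith [mul_le_mul_of_nonneg_right (le_abs_self b) (zero_le_one.trans hlog)]
  rw [div_mul_div_comm, div_le_iff₀ (by positivity), mul_comm (T : ℝ)]
  exact h.trans (by gcongr)

end LowerBound

end Congest

theorem mainTheorem3_general {W : Type*} [Finite W] (H : SimpleGraph W) (hH : ¬ H.CliqueFree 4) :
    ∃ c : ℝ, 0 < c ∧ ∃ n₀ : ℕ, ∀ n : ℕ, n₀ ≤ n →
      ∀ (B : ℕ) (A : Congest.Algorithm n B) (T : ℕ) (P : SimpleGraph (Fin n) → Prop),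
        (∀ G, H.IsIndContained G → P G) → (∀ G, P G → H.IsContained G) → A.DecidesIn P T →
          c * √n ≤ (B + 1) * T := by
  cases nonempty_fintype W
  have : Nonempty W := ⟨(SimpleGraph.topEmbeddingOfNotCliqueFree hH) 0⟩
  set w := Fintype.card W
  have hw : 0 < w := Fintype.card_pos
  refine ⟨1 / (160000 * w ^ 2 * √(32 * w)), by positivity, 60000 * w,
    fun n hn B A T P hInd hSub hA => ?_⟩
  obtain ⟨q, hodd, hqn, hnq⟩ := Congest.exists_odd_sq_mul_lt hw (by linarith : 32 * w ≤ n)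
  have hq : 40 ≤ q := by
    by_contra! hq
    have hsq : q ^ 2 ≤ 39 ^ 2 := by
      gcongr
      omega
    nlinarith [Nat.mul_le_mul_left (32 * w) hsq]
  have hqT := Congest.le_of_exp_pow_four_le hq
    (Congest.exp_le_of_decidesIn hH hodd hqn hInd hSub hA)
  have hsqrt : √n ≤ √(32 * w) * q := by
    rw [← Real.sqrt_sq (Nat.cast_nonneg q), ← Real.sqrt_mul (by positivity)]
    exact Real.sqrt_le_sqrt (mod_cast hnq)
  rw [one_div_mul_eq_div, div_le_iff₀ (by positivity)]
  calc √n ≤ √(32 * w) * q := hsqrt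
    _ ≤ √(32 * w) * (160000 * w ^ 2 * ((B + 1) * T : ℕ)) := by gcongr
    _ = (B + 1) * T * (160000 * w ^ 2 * √(32 * w)) := by
      push_cast
      ring

theorem mainTheorem3 {W : Type*} [Finite W] (H : SimpleGraph W) (hH : ¬ H.CliqueFree 4) (b : ℝ) :
    ∃ c : ℝ, 0 < c ∧ ∃ n₀ : ℕ, ∀ n : ℕ, n₀ ≤ n →
      ∀ B : ℕ, (B : ℝ) ≤ b * Real.log n →
        ∀ (A : Congest.Algorithm n B) (T : ℕ),
          (A.SolvesDetection H T ∨ A.SolvesInducedDetection H T) →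
            c * ((n : ℝ) ^ (1 / 2 : ℝ) / Real.log n) ≤ T := by
  obtain ⟨c, hc, n₀, hbound⟩ := mainTheorem3_general H hH
  refine ⟨c / (|b| + 1), by positivity, max n₀ 3, fun n hn B hB A T hA => ?_⟩
  rw [← Real.sqrt_eq_rpow]
  exact Congest.mul_sqrt_div_log_le (le_of_max_le_right hn) hB <| hA.elim
    (hbound n (le_of_max_le_left hn) B A T _ (fun _ h => h.isContained) fun _ => id)
    (hbound n (le_of_max_le_left hn) B A T _ (fun _ => id) fun _ h => h.isContained)
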